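/- Let $p$ be a prime (possibly $p=2$), and let $R$ be a commutative ring containing a primitive $p$-th root of one $\rho$, in the sense that $R$ is a $\mathbb{Z}[\rho]$-algebra, i.e. an element $\rho\in R$ with $1+\rho+\cdots+\rho^{p-1}=0$ is fixed. Put $\eta=\rho-1$. Let $S/R$ be a Galois extension of commutative rings with group $G=\langle\sigma\rangle$ of order $p$; that is, $R\subseteq S$, $S$ is a finitely generated projective $R$-module, $G$ acts on $S$ by $R$-algebra automorphisms, and the map $\bigoplus_{g\in G}Sg\to\operatorname{End}_R(S)$ from the twisted group ring (with $gs=g(s)g$), sending $\sum_g s_g g$ to $x\mapsto\sum_g s_g\,g(x)$, is an isomorphism. For an $R[G]$-module $M$ write $M(1)=\{x\in M : (\sigma-\rho)(\sigma-1)x=0\}$; in particular $R[G](1)$ is the ideal of $R[G]$ generated by $(\sigma-\rho^{2})\cdots(\sigma-\rho^{p-1})$. Then the following are equivalent: 1. there is an $\alpha\in S$ with $\sigma(\alpha)=\rho\alpha+1$ and $1+\eta\alpha$ invertible in $S$; 2. $S(1)\cong R[G](1)$ as $R[G]$-modules; 3. $S\cong R[G]$ as $R[G]$-modules. -/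

import Mathlib

open scoped MonoidAlgebra

/-- For a group `G` acting on the commutative `R`-algebra `S` by `R`-algebra automorphisms, the
canonical map `φ : Δ(S/R, G) → End_R(S)`.  The twisted group ring `Δ(S/R, G) = ⨁_g S g`
(with `g s = g(s) g`) is represented by its underlying module `G → S`; the element `∑ s_g g` is
sent to the endomorphism `x ↦ ∑ s_g g(x)`.  This is a ring homomorphism, so it is an isomorphism
of rings exactly when it is bijective. -/
noncomputable def twistedGroupRingToEnd (R S G : Type*) [CommRing R] [CommRing S] [Algebra R S]
    [Group G] [Fintype G] [MulSemiringAction G S] [SMulCommClass G R S] :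
    (G → S) → Module.End R S :=
  fun s => ∑ g : G, LinearMap.mulLeft R (s g) ∘ₗ DistribSMul.toLinearMap R S g

/-- `S/R` is a Galois extension of commutative rings with finite group `G`: `R` is a subring
of `S`, `S` is a finitely generated projective `R`-module, and the canonical map from the twisted
group ring `Δ(S/R, G)` to `End_R(S)` is an isomorphism. -/
structure IsGaloisRingExtension (R S G : Type*) [CommRing R] [CommRing S] [Algebra R S]
    [Group G] [Fintype G] [MulSemiringAction G S] [SMulCommClass G R S] : Prop where
  injective : Function.Injective (algebraMap R S)
  finite : Module.Finite R S
  projective : Module.Projective R S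
  bijective : Function.Bijective (twistedGroupRingToEnd R S G)

/-- `S` viewed as a module over the group ring `R[G]`. -/
abbrev GaloisModule (R S G : Type*) [CommRing R] [CommRing S] [Algebra R S]
    [Group G] [MulSemiringAction G S] [SMulCommClass G R S] : Type _ :=
  (Representation.ofDistribMulAction R G S).asModule

/-- For an `R[G]`-module `M`, `σ ∈ G` and `ρ ∈ R`, the `R[G]`-submodule
`M(1) = {x ∈ M | (σ - ρ)(σ - 1) x = 0}`. -/
noncomputable def firstLayer {R G : Type*} [CommRing R] [CommGroup G] (σ : G) (ρ : R)
    (M : Type*) [AddCommGroup M] [Module R[G] M] : Submodule R[G] M :=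
  Submodule.torsionBy R[G] M
    ((MonoidAlgebra.of R G σ - algebraMap R R[G] ρ) * (MonoidAlgebra.of R G σ - 1))

theorem X_pow_sub_one_eq_prod_of_isRoot_cyclotomic {R : Type*} [CommRing R] {p : ℕ}
    (hp : p.Prime) {ρ : R} (hρ : (Polynomial.cyclotomic p R).IsRoot ρ) :
    (Polynomial.X ^ p - 1 : Polynomial R) =
      ∏ i ∈ Finset.range p, (Polynomial.X - Polynomial.C (ρ ^ i)) := by
  have hirr : Prime (Polynomial.cyclotomic p ℤ) :=
    (Polynomial.cyclotomic.irreducible hp.pos).prime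
  have : IsDomain (AdjoinRoot (Polynomial.cyclotomic p ℤ)) := AdjoinRoot.isDomain_of_prime hirr
  have hdeg : (Polynomial.cyclotomic p ℤ).degree ≠ 0 :=
    (Polynomial.degree_cyclotomic_pos p ℤ hp.pos).ne'
  have : NeZero ((p : ℕ) : AdjoinRoot (Polynomial.cyclotomic p ℤ)) := by
    refine ⟨fun h => hp.ne_zero ?_⟩
    have := AdjoinRoot.of.injective_of_degree_ne_zero hdeg (a₁ := (p : ℤ)) (a₂ := 0)
      (by simpa using h)
    exact_mod_cast this
  have hζ : IsPrimitiveRoot (AdjoinRoot.root (Polynomial.cyclotomic p ℤ)) p := by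
    rw [← Polynomial.isRoot_cyclotomic_iff, Polynomial.IsRoot.def,
      ← Polynomial.map_cyclotomic_int p (AdjoinRoot (Polynomial.cyclotomic p ℤ)),
      Polynomial.eval_map, RingHom.ext_int (Int.castRingHom _)
        (AdjoinRoot.of (Polynomial.cyclotomic p ℤ))]
    exact AdjoinRoot.eval₂_root (Polynomial.cyclotomic p ℤ)
  have key : (Polynomial.X ^ p - 1 : Polynomial (AdjoinRoot (Polynomial.cyclotomic p ℤ))) =
      ∏ i ∈ Finset.range p,
        (Polynomial.X - Polynomial.C (AdjoinRoot.root (Polynomial.cyclotomic p ℤ) ^ i)) := by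
    classical
    rw [Polynomial.X_pow_sub_one_eq_prod hp.pos hζ, Polynomial.nthRootsFinset,
      Finset.prod_eq_multiset_prod, Multiset.toFinset_val, hζ.nthRoots_one_nodup.dedup,
      hζ.nthRoots_eq (one_pow p), Multiset.map_map]
    simp [Finset.prod_eq_multiset_prod]
  have hev : Polynomial.eval₂ (Int.castRingHom R) ρ (Polynomial.cyclotomic p ℤ) = 0 := by
    rw [← Polynomial.eval_map, Polynomial.map_cyclotomic_int]
    exact hρ
  have := congrArg (Polynomial.map (AdjoinRoot.lift (Int.castRingHom R) ρ hev)) key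
  simpa [Polynomial.map_prod] using this

/-- For `M = R[G]`, with `G` generated by `σ` of prime order `p` and `ρ` a root of the `p`-th
cyclotomic polynomial, `R[G](1)` is the ideal generated by `(σ - ρ ^ 2) ⋯ (σ - ρ ^ (p - 1))`. -/
theorem firstLayer_groupRing {R G : Type*} [CommRing R] [CommGroup G] [Fintype G] {p : ℕ}
    (hp : p.Prime) (hcard : Fintype.card G = p) (σ : G) (hσ : Subgroup.zpowers σ = ⊤)
    (ρ : R) (hρ : (Polynomial.cyclotomic p R).IsRoot ρ) :
    firstLayer σ ρ R[G] = Ideal.span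
      {∏ i ∈ Finset.Ico 2 p, (MonoidAlgebra.of R G σ - algebraMap R R[G] (ρ ^ i))} := by
  classical
  have hord : orderOf σ = p := by
    rw [← hcard, ← Nat.card_eq_fintype_card]
    exact orderOf_eq_card_of_forall_mem_zpowers (fun x => hσ ▸ Subgroup.mem_top x)
  have hfac := X_pow_sub_one_eq_prod_of_isRoot_cyclotomic hp hρ
  rw [← Finset.prod_range_mul_prod_Ico _ hp.two_le, Finset.prod_range_succ,
    Finset.prod_range_one, pow_zero, pow_one, map_one] at hfac
  set g : Polynomial R := (Polynomial.X - 1) * (Polynomial.X - Polynomial.C ρ) with hg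
  set f : Polynomial R := ∏ i ∈ Finset.Ico 2 p, (Polynomial.X - Polynomial.C (ρ ^ i)) with hf
  have hgm : g.Monic := (by simpa using Polynomial.monic_X_sub_C (1 : R) :
    (Polynomial.X - 1 : Polynomial R).Monic).mul (Polynomial.monic_X_sub_C ρ)
  let φ : Polynomial R →ₐ[R] R[G] := Polynomial.aeval (MonoidAlgebra.of R G σ)
  have hφg : φ g =
      (MonoidAlgebra.of R G σ - algebraMap R R[G] ρ) * (MonoidAlgebra.of R G σ - 1) := by
    simp [φ, hg, mul_comm]
  have hφf : φ f =
      ∏ i ∈ Finset.Ico 2 p, (MonoidAlgebra.of R G σ - algebraMap R R[G] (ρ ^ i)) := by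
    simp [φ, hf]
  have hσp : σ ^ p = 1 := hord ▸ pow_orderOf_eq_one σ
  have hφ0 : φ (Polynomial.X ^ p - 1) = 0 := by
    simp only [φ, map_sub, map_pow, Polynomial.aeval_X, map_one]
    rw [← map_pow, hσp, map_one, sub_self]
  have hXm : (Polynomial.X ^ p - 1 : Polynomial R).Monic := by
    simpa using Polynomial.monic_X_pow_sub_C (1 : R) hp.ne_zero
  have hsurj : Function.Surjective φ := by
    intro x
    induction x using MonoidAlgebra.induction_on with
    | of y =>
      obtain ⟨n, rfl⟩ : ∃ n : ℕ, σ ^ n = y :=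
        (Submonoid.mem_powers_iff _ _).1
          (mem_powers_iff_mem_zpowers.2 (hσ ▸ Subgroup.mem_top y))
      exact ⟨Polynomial.X ^ n, by simp [φ]⟩
    | add a b ha hb =>
      obtain ⟨a, rfl⟩ := ha
      obtain ⟨b, rfl⟩ := hb
      exact ⟨a + b, map_add _ _ _⟩
    | smul r a ha =>
      obtain ⟨a, rfl⟩ := ha
      exact ⟨r • a, map_smul _ _ _⟩
  have hker : ∀ h : Polynomial R, φ h = 0 → (Polynomial.X ^ p - 1 : Polynomial R) ∣ h := by
    intro h hh
    nontriviality R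
    rw [← Polynomial.modByMonic_eq_zero_iff_dvd hXm]
    set r := h %ₘ (Polynomial.X ^ p - 1) with hr
    have hdeg : r.natDegree < p := by
      have h1 := Polynomial.natDegree_modByMonic_lt h hXm (by
        intro h1
        have := congrArg Polynomial.natDegree h1
        rw [← Polynomial.C_1, Polynomial.natDegree_X_pow_sub_C] at this
        simp [hp.ne_zero] at this)
      rwa [← Polynomial.C_1, Polynomial.natDegree_X_pow_sub_C] at h1
    have hφr : φ r = 0 := by
      have h1 := congrArg φ (Polynomial.modByMonic_add_div h (Polynomial.X ^ p - 1))
      rw [map_add, map_mul, hφ0, zero_mul, add_zero, hh] at h1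
      exact h1
    have hsum : φ r = ∑ i ∈ Finset.range p, MonoidAlgebra.single (σ ^ i) (r.coeff i) := by
      simp only [φ]
      rw [Polynomial.aeval_eq_sum_range' hdeg]
      refine Finset.sum_congr rfl fun i _ => ?_
      rw [← map_pow]
      simp
    ext j
    rw [Polynomial.coeff_zero]
    by_cases hj : j < p
    · have h1 := congrArg (fun x : R[G] => x.coeff (σ ^ j)) (hsum.symm.trans hφr)
      simp only [MonoidAlgebra.coeff_sum, Finsupp.finsetSum_apply] at h1
      rw [Finset.sum_eq_single j] at h1
      · simpa using h1
      · intro i hi hij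
        rw [MonoidAlgebra.coeff_single, Finsupp.single_apply, if_neg]
        intro h2
        exact hij (pow_injOn_Iio_orderOf (by simpa [hord] using hi) (by simpa [hord] using hj) h2)
      · intro h2
        exact absurd (Finset.mem_range.2 hj) h2
    · exact Polynomial.coeff_eq_zero_of_natDegree_lt (by omega)
  ext x
  rw [Ideal.mem_span_singleton, firstLayer, Submodule.mem_torsionBy_iff, smul_eq_mul,
    ← hφg, ← hφf]
  constructor
  · intro hx
    obtain ⟨h, rfl⟩ := hsurj x
    rw [← map_mul] at hx
    have h1 := hker _ hx
    rw [hfac] at h1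
    obtain ⟨k, hk⟩ := h1
    rw [mul_assoc g f k] at hk
    have h2 : h = f * k := hgm.isRegular.left hk
    exact ⟨φ k, by rw [h2, map_mul]⟩
  · rintro ⟨y, rfl⟩
    rw [← mul_assoc, ← map_mul, ← hfac, hφ0, zero_mul]

/-! Write `[k] = 1 + ρ + ⋯ + ρ^(k-1)`, a unit for `0 < k < p`, and `v = 1 + ηα`.

1 → 3: since `σ^n α = α + [n]v`, the conjugates of `α` differ by units, so a Vandermonde argument
makes the powers of `α` an `R`-basis of `S`. For the `q`-falling factorials `P_k = ∏_{i<k} (α -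
[i])`, the operator `σ - ρ^(k+1)` sends `P_(k+1)` to a unit of `R` times `P_k`. Hence `P_(p-1)`
generates `S` over `R[G]`, and a surjection between free `R`-modules of equal rank is bijective.

3 → 2 is functoriality.

2 → 1: a generator `b` of `S(1)` has `(σ - ρ)b` spanning `S^G = R` and `(σ - 1)b` spanning the
`ρ`-eigenspace. Scaling `b` gives `α` with `σα = ρα + 1`, and `v = (σ - 1)α` divides every
`ρ`-eigenvector. If `v` lay in a maximal ideal `M`, then `p ∉ M`, and Lagrange resolvents would make
`σ` trivial modulo `M`, contradicting the Galois property. -/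

namespace IsGaloisRingExtension

/-! ### Consequences of the Galois condition -/

variable {R S G : Type*} [CommRing R] [CommRing S] [Algebra R S]
  [Group G] [Fintype G] [MulSemiringAction G S] [SMulCommClass G R S]

theorem twistedGroupRingToEnd_apply (s : G → S) (x : S) :
    twistedGroupRingToEnd R S G s x = ∑ g : G, s g * g • x := by
  simp [twistedGroupRingToEnd]

/-- Every linear form on a Galois extension is of the form `x ↦ Tr(t x)`. -/
theorem exists_eq_trace_mul (h : IsGaloisRingExtension R S G) (f : S →ₗ[R] R) :
    ∃ t : S, ∀ x : S, algebraMap R S (f x) = ∑ g : G, g • (t * x) := by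
  obtain ⟨s, hs⟩ := h.bijective.2 (Algebra.linearMap R S ∘ₗ f)
  have hs' : ∀ x, ∑ g : G, s g * g • x = algebraMap R S (f x) := fun x => by
    rw [← twistedGroupRingToEnd_apply (R := R), hs]; rfl
  -- The values of `f` are `G`-fixed, so uniqueness of coefficients makes `s` equivariant: `s g = g
  -- • s 1`.
  have key : ∀ k : G, (fun g => k • s (k⁻¹ * g)) = s := fun k => by
    apply h.bijective.1
    ext x
    rw [twistedGroupRingToEnd_apply, twistedGroupRingToEnd_apply, hs',
      ← smul_algebraMap k (f x), ← hs', Finset.smul_sum]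
    refine Fintype.sum_equiv (Equiv.mulLeft k⁻¹) _ _ fun g => ?_
    simp [smul_mul', smul_smul]
  refine ⟨s 1, fun x => ?_⟩
  rw [← hs']
  refine Finset.sum_congr rfl fun g _ => ?_
  rw [smul_mul', ← congrFun (key g) g, inv_mul_cancel]

/-- A finite dual basis of a Galois extension, with linear forms written through the trace. -/
theorem exists_dual_basis (h : IsGaloisRingExtension R S G) :
    ∃ (n : ℕ) (x t : Fin n → S) (f : Fin n → S →ₗ[R] R),
      (∀ i y, algebraMap R S (f i y) = ∑ g : G, g • (t i * y)) ∧
      ∀ y, ∑ i, f i y • x i = y := by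
  have := h.finite
  have := h.projective
  obtain ⟨n, F, K, -, -, hFK⟩ := Module.Finite.exists_comp_eq_id_of_projective R S
  choose t ht using fun i : Fin n => h.exists_eq_trace_mul (LinearMap.proj i ∘ₗ K)
  refine ⟨n, fun i => F (fun j => if i = j then 1 else 0), t, fun i => LinearMap.proj i ∘ₗ K, ht, fun y => ?_⟩
  have h1 : F (K y) = y := LinearMap.congr_fun hFK y
  exact (LinearMap.pi_apply_eq_sum_univ F (K y)).symm.trans h1

/-- The elements of a Galois extension fixed by the group are those of the base ring. -/
theorem exists_algebraMap_eq_of_smul_eq (h : IsGaloisRingExtension R S G) {s : S}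
    (hs : ∀ g : G, g • s = s) : ∃ r : R, algebraMap R S r = s := by
  obtain ⟨n, x, t, f, hf, hx⟩ := h.exists_dual_basis
  have := h.finite
  -- The dual basis gives `S = I S`; Nakayama and faithfulness of `S` then force `I = R`.
  let I : Ideal R := Ideal.span {r | ∃ i y, f i y = r}
  obtain ⟨r, hr, hr0⟩ := Submodule.exists_sub_one_mem_and_smul_eq_zero_of_fg_of_le_smul I
    (⊤ : Submodule R S) Module.Finite.fg_top (fun y _ => by
      rw [← hx y]
      exact Submodule.sum_mem _ fun i _ => Submodule.smul_mem_smul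
        (Ideal.subset_span ⟨i, y, rfl⟩) trivial)
  have hr1 : r = 0 := h.injective (by
    simpa [Algebra.smul_def] using hr0 1 trivial)
  have h1 : (1 : R) ∈ I := by
    rw [hr1, zero_sub] at hr
    simpa using I.neg_mem hr
  have key : ∀ a ∈ I, ∃ r : R, algebraMap R S r = algebraMap R S a * s := by
    intro a ha
    induction ha using Submodule.span_induction with
    | mem a ha =>
      obtain ⟨i, y, rfl⟩ := ha
      refine ⟨f i (y * s), ?_⟩
      rw [hf, hf, Finset.sum_mul]
      refine Finset.sum_congr rfl fun g _ => ?_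
      rw [← mul_assoc, smul_mul' g _ s, hs]
    | zero => exact ⟨0, by simp⟩
    | add a b _ _ ha hb =>
      obtain ⟨u, hu⟩ := ha
      obtain ⟨v, hv⟩ := hb
      exact ⟨u + v, by rw [map_add, hu, hv, map_add, add_mul]⟩
    | smul c a _ ha =>
      obtain ⟨u, hu⟩ := ha
      exact ⟨c * u, by rw [map_mul, hu, smul_eq_mul, map_mul, mul_assoc]⟩
  simpa using key 1 h1

/-- A nontrivial element of the group moves some element modulo any given proper ideal. -/
theorem exists_smul_sub_notMem (h : IsGaloisRingExtension R S G) {g : G} (hg : g ≠ 1)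
    (M : Ideal S) (hM : M ≠ ⊤) : ∃ s : S, g • s - s ∉ M := by
  classical
  obtain ⟨n, x, t, f, hf, hx⟩ := h.exists_dual_basis
  -- Both sides are coefficients of the identity endomorphism.
  have key : (fun k : G => ∑ i, x i * k • t i) = Pi.single 1 1 := by
    apply h.bijective.1
    ext y
    rw [twistedGroupRingToEnd_apply, twistedGroupRingToEnd_apply]
    have h1 : ∑ k : G, (∑ i, x i * k • t i) * k • y = y := by
      conv_rhs => rw [← hx y]
      simp_rw [Algebra.smul_def, hf, Finset.sum_mul]
      rw [Finset.sum_comm]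
      refine Finset.sum_congr rfl fun i _ => Finset.sum_congr rfl fun k _ => ?_
      rw [smul_mul']
      ring
    rw [h1, Finset.sum_eq_single 1]
    · simp
    · intro k _ hk
      simp [Pi.single_eq_of_ne hk]
    · simp
  by_contra! hc
  refine hM ((Ideal.eq_top_iff_one M).2 ?_)
  have h1 : ∑ i, x i * (1 : G) • t i = 1 := by simpa using congrFun key 1
  have h2 : ∑ i, x i * g • t i = 0 := by simpa [hg] using congrFun key g
  have h3 : (1 : S) = -∑ i, x i * (g • t i - t i) := by
    simp_rw [mul_sub, Finset.sum_sub_distrib, h2]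
    simpa using h1.symm
  rw [h3]
  exact M.neg_mem (M.sum_mem fun i _ => M.mul_mem_left _ (hc _))

end IsGaloisRingExtension

/-! ### Geometric sums at a root of unity -/

section GeomSum

variable {A : Type*} [CommRing A]

theorem geom_sum_range_mul (x : A) (k l : ℕ) :
    ∑ i ∈ Finset.range (k * l), x ^ i =
      (∑ i ∈ Finset.range k, x ^ i) * ∑ j ∈ Finset.range l, (x ^ k) ^ j := by
  induction l with
  | zero => simp
  | succ l ih =>
    rw [mul_add, mul_one, Finset.sum_range_add, ih, Finset.sum_range_succ, mul_add,
      Finset.sum_mul (s := Finset.range k) (a := (x ^ k) ^ l)]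
    congr 1
    refine Finset.sum_congr rfl fun i _ => ?_
    rw [pow_add, pow_mul, mul_comm]

/-- If `1 + x + ⋯ + x ^ (p - 1) = 0`, then `1 + x + ⋯ + x ^ (k - 1)` is a unit for every `k`
prime to `p`. -/
theorem isUnit_geom_sum_of_coprime {x : A} {p k : ℕ} (hp : 1 < p)
    (hx : ∑ i ∈ Finset.range p, x ^ i = 0) (hk : k.Coprime p) :
    IsUnit (∑ i ∈ Finset.range k, x ^ i) := by
  obtain ⟨l, hl⟩ := Nat.exists_mul_mod_eq_one_of_coprime hk hp
  refine IsUnit.of_mul_eq_one (∑ j ∈ Finset.range l, (x ^ k) ^ j) ?_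
  -- As `k * l ≡ 1` mod `p`, full periods vanish and only the last term `x ^ (p * m) = 1` remains.
  rw [← geom_sum_range_mul, ← Nat.div_add_mod (k * l) p, hl.2, Finset.sum_range_succ,
    geom_sum_range_mul, hx, zero_mul, zero_add, pow_mul]
  have h1 : x ^ p = 1 := by
    have := geom_sum_mul x p
    rw [hx, zero_mul] at this
    exact (sub_eq_zero.1 this.symm)
  rw [h1, one_pow]

end GeomSum

/-! ### Power bases and `q`-falling factorials -/

section Cyclic

variable {R S G : Type*} [CommRing R] [CommRing S] [Algebra R S]
  [Group G] [MulSemiringAction G S] [SMulCommClass G R S]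

theorem smul_eq_of_zpowers_eq_top {σ : G} (hσ : Subgroup.zpowers σ = ⊤) {s : S}
    (hs : σ • s = s) (g : G) : g • s = s := by
  have h : Subgroup.zpowers σ ≤ MulAction.stabilizer G s := by
    rw [Subgroup.zpowers_le]
    exact hs
  exact h (hσ ▸ Subgroup.mem_top g)

/-- If the conjugates of `α` under a cyclic group of order `p` with fixed ring `R` are pairwise
distinct modulo every maximal ideal, then `1, α, …, α ^ (p - 1)` is a basis over `R`. -/
theorem bijective_sum_smul_pow {p : ℕ} (hp : 0 < p) {σ : G} (hσ : Subgroup.zpowers σ = ⊤)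
    (hσp : σ ^ p = 1) (hinj : Function.Injective (algebraMap R S))
    (hfix : ∀ s : S, (∀ g : G, g • s = s) → ∃ r : R, algebraMap R S r = s) (α : S)
    (hα : ∀ i j : ℕ, i < j → j < p → IsUnit (σ ^ j • α - σ ^ i • α)) :
    Function.Bijective
      (Fintype.linearCombination R (fun j : Fin p => α ^ (j : ℕ))) := by
  set A : Matrix (Fin p) (Fin p) S := Matrix.vandermonde fun i : Fin p => σ ^ (i : ℕ) • α with hA
  have hdet : IsUnit A.det := by
    rw [hA, Matrix.det_vandermonde, IsUnit.prod_univ_iff]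
    intro i
    rw [IsUnit.prod_iff]
    intro j hj
    exact hα i j (Fin.lt_def.1 (Finset.mem_Ioi.1 hj)) j.2
  have hmul : ∀ (c : Fin p → S) (n : ℕ), (A.mulVec c) ⟨n % p, Nat.mod_lt n hp⟩ =
      ∑ j : Fin p, σ ^ n • α ^ (j : ℕ) * c j := by
    intro c n
    simp [hA, Matrix.mulVec, dotProduct, Matrix.vandermonde_apply, smul_pow',
      ← pow_eq_pow_mod n hσp]
  have hAinj : Function.Injective A.mulVec :=
    Matrix.mulVec_injective_of_isUnit ((Matrix.isUnit_iff_isUnit_det A).2 hdet)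
  constructor
  · rw [injective_iff_map_eq_zero]
    intro c hc
    rw [Fintype.linearCombination_apply] at hc
    have h1 : (fun j => algebraMap R S (c j)) = 0 := by
      apply hAinj
      ext i
      have h2 := hmul (fun j => algebraMap R S (c j)) i
      have h3 : (⟨(i : ℕ) % p, Nat.mod_lt _ hp⟩ : Fin p) = i :=
        Fin.ext (Nat.mod_eq_of_lt i.2)
      rw [h3] at h2
      rw [h2, Matrix.mulVec_zero, Pi.zero_apply, ← smul_zero (σ ^ (i : ℕ)), ← hc,
        Finset.smul_sum]
      refine Finset.sum_congr rfl fun j _ => ?_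
      rw [Algebra.smul_def, smul_mul', smul_algebraMap, mul_comm]
    ext j
    exact hinj (by simpa using congrFun h1 j)
  · intro s
    set c : Fin p → S := A⁻¹.mulVec fun i : Fin p => σ ^ (i : ℕ) • s with hc
    have hAc : A.mulVec c = fun i : Fin p => σ ^ (i : ℕ) • s := by
      rw [hc, Matrix.mulVec_mulVec, Matrix.mul_nonsing_inv A hdet, Matrix.one_mulVec]
    have hn : ∀ n : ℕ, ∑ j : Fin p, σ ^ n • α ^ (j : ℕ) * c j = σ ^ n • s := by
      intro n
      rw [← hmul, hAc]
      simp [← pow_eq_pow_mod n hσp]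
    -- Applying `σ⁻¹` permutes the linear equations for `c` cyclically, so uniqueness makes `c`
    -- fixed and hence `R`-valued.
    have hcσ : (fun j => σ⁻¹ • c j) = c := by
      apply hAinj
      ext i
      have h2 := hmul (fun j => σ⁻¹ • c j) i
      have h3 : (⟨(i : ℕ) % p, Nat.mod_lt _ hp⟩ : Fin p) = i :=
        Fin.ext (Nat.mod_eq_of_lt i.2)
      rw [h3] at h2
      rw [h2, hAc]
      have h4 := congrArg (σ⁻¹ • ·) (hn (i + 1))
      simpa [Finset.smul_sum, smul_mul', smul_smul, pow_succ'] using h4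
    choose r hr using fun j => hfix (c j) (smul_eq_of_zpowers_eq_top hσ (by
      conv_lhs => rw [← congrFun hcσ j]
      rw [smul_inv_smul]))
    refine ⟨r, ?_⟩
    rw [Fintype.linearCombination_apply]
    have h0 := hn 0
    simp only [pow_zero, one_smul] at h0
    rw [← h0]
    refine Finset.sum_congr rfl fun j _ => ?_
    rw [Algebra.smul_def, hr, mul_comm]

/-- The increment `σα - α = 1 + (ρ - 1)α` is a `ρ`-eigenvector of `σ`, so its translates sum
geometrically. -/
theorem pow_smul_eq_of_smul_eq {σ : G} {ρ : R} {α : S}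
    (hα : σ • α = algebraMap R S ρ * α + 1) (n : ℕ) :
    σ ^ n • α = α + (∑ i ∈ Finset.range n, algebraMap R S ρ ^ i) *
      (1 + α * algebraMap R S (ρ - 1)) := by
  induction n with
  | zero => simp
  | succ n ih =>
    rw [pow_succ, mul_smul, hα, smul_add, smul_mul', smul_algebraMap, smul_one, ih,
      geom_sum_succ, map_sub, map_one]
    ring

/-- Because `σ(α - [i+1]) = ρ(α - [i])`, `σ` shifts the factors of the product down by one. -/
theorem smul_prod_sub_geom_sum {σ : G} {ρ : R} {α : S}
    (hα : σ • α = algebraMap R S ρ * α + 1) (k : ℕ) :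
    σ • ∏ i ∈ Finset.range (k + 1), (α - ∑ j ∈ Finset.range i, algebraMap R S ρ ^ j) -
        algebraMap R S ρ ^ (k + 1) *
          ∏ i ∈ Finset.range (k + 1), (α - ∑ j ∈ Finset.range i, algebraMap R S ρ ^ j) =
      algebraMap R S (ρ ^ k * ∑ j ∈ Finset.range (k + 1), ρ ^ j) *
        ∏ i ∈ Finset.range k, (α - ∑ j ∈ Finset.range i, algebraMap R S ρ ^ j) := by
  set q := algebraMap R S ρ with hq
  have hσq : σ • q = q := smul_algebraMap σ ρ
  have h1 : σ • ∏ i ∈ Finset.range (k + 1), (α - ∑ j ∈ Finset.range i, q ^ j) =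
      q ^ k * (∏ i ∈ Finset.range k, (α - ∑ j ∈ Finset.range i, q ^ j)) * (q * α + 1) := by
    rw [Finset.smul_prod', Finset.prod_range_succ']
    have h2 : ∀ i, σ • (α - ∑ j ∈ Finset.range (i + 1), q ^ j) =
        q * (α - ∑ j ∈ Finset.range i, q ^ j) := fun i => by
      rw [smul_sub, hα, Finset.smul_sum]
      simp only [smul_pow', hσq]
      rw [geom_sum_succ]
      ring
    simp [h2, Finset.prod_mul_distrib, hα]
  rw [h1, Finset.prod_range_succ, map_mul, map_sum]
  simp only [map_pow, ← hq]
  rw [geom_sum_succ]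
  ring

end Cyclic

/-! ### A normal basis generator from `α` -/

section NormalBasis

variable {R S G : Type*} [CommRing R] [CommRing S] [Algebra R S]
  [CommGroup G] [MulSemiringAction G S] [SMulCommClass G R S]

theorem nonempty_linearEquiv_groupRing_of_bijective (w : S)
    (hw : Function.Bijective fun x : R[G] =>
      (Representation.ofDistribMulAction R G S).asAlgebraHom x w) :
    Nonempty (GaloisModule R S G ≃ₗ[R[G]] R[G]) :=
  ⟨(LinearEquiv.ofBijective (LinearMap.toSpanSingleton R[G] (GaloisModule R S G)
    ((Representation.ofDistribMulAction R G S).asModuleEquiv.symm w)) hw).symm⟩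

theorem IsGaloisRingExtension.nonempty_linearEquiv_groupRing [Fintype G] {p : ℕ} (hp : p.Prime)
    (hcard : Fintype.card G = p) {σ : G} (hσ : Subgroup.zpowers σ = ⊤) {ρ : R}
    (hρ : ∑ i ∈ Finset.range p, ρ ^ i = 0) (hGal : IsGaloisRingExtension R S G) {α : S}
    (hα : σ • α = algebraMap R S ρ * α + 1) (hu : IsUnit (1 + α * algebraMap R S (ρ - 1))) :
    Nonempty (GaloisModule R S G ≃ₗ[R[G]] R[G]) := by
  have hσp : σ ^ p = 1 := hcard ▸ pow_card_eq_one
  have hunit : ∀ k, 0 < k → k < p → IsUnit (∑ i ∈ Finset.range k, ρ ^ i) := fun k h0 hk =>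
    isUnit_geom_sum_of_coprime hp.one_lt hρ
      (Nat.Coprime.symm ((Nat.Prime.coprime_iff_not_dvd hp).2 (Nat.not_dvd_of_pos_of_lt h0 hk)))
  have hbij : Function.Bijective (Fintype.linearCombination R (fun j : Fin p => α ^ (j : ℕ))) := by
    refine bijective_sum_smul_pow hp.pos hσ hσp hGal.injective
      (fun s hs => hGal.exists_algebraMap_eq_of_smul_eq hs) α fun i j hij hj => ?_
    obtain ⟨d, rfl⟩ := Nat.exists_eq_add_of_lt hij
    rw [add_assoc, pow_add, mul_smul, ← smul_sub, pow_smul_eq_of_smul_eq hα, add_sub_cancel_left]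
    refine IsUnit.map (MulSemiringAction.toRingHom G S (σ ^ i)) (IsUnit.mul ?_ hu)
    have := (hunit (d + 1) (by omega) (by omega)).map (algebraMap R S)
    simpa using this
  have hρunit : IsUnit ρ := by
    have := geom_sum_mul ρ p
    rw [hρ, zero_mul] at this
    exact IsUnit.of_pow_eq_one (sub_eq_zero.1 this.symm) hp.ne_zero
  set P : ℕ → S := fun k =>
    ∏ i ∈ Finset.range k, (α - ∑ j ∈ Finset.range i, algebraMap R S ρ ^ j) with hP
  let Ψ : R[G] →ₗ[R] S := (LinearMap.applyₗ (P (p - 1))) ∘ₗ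
    (Representation.ofDistribMulAction R G S).asAlgebraHom.toLinearMap
  have hΨ : ∀ x, Ψ x = (Representation.ofDistribMulAction R G S).asAlgebraHom x (P (p - 1)) :=
    fun x => rfl
  have hσN : ∀ y ∈ LinearMap.range Ψ, σ • y ∈ LinearMap.range Ψ := by
    rintro _ ⟨x, rfl⟩
    exact ⟨MonoidAlgebra.of R G σ * x, by simp [hΨ]⟩
  have hPN : ∀ d k, k + d = p - 1 → P k ∈ LinearMap.range Ψ := by
    intro d
    induction d with
    | zero =>
      rintro k rfl
      exact ⟨1, by rw [hΨ]; simp⟩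
    | succ d ih =>
      intro k hk
      have h1 := ih (k + 1) (by omega)
      obtain ⟨u, hu'⟩ := (hρunit.pow k).mul (hunit (k + 1) (by omega) (by omega))
      have h2 := smul_prod_sub_geom_sum hα k
      rw [← hu', ← map_pow, ← Algebra.smul_def, ← Algebra.smul_def] at h2
      have h3 : P k = (↑u⁻¹ : R) • (σ • P (k + 1) - (ρ ^ (k + 1)) • P (k + 1)) := by
        rw [h2, smul_smul, Units.inv_mul, one_smul]
      rw [h3]
      exact Submodule.smul_mem _ _ (Submodule.sub_mem _ (hσN _ h1) (Submodule.smul_mem _ _ h1))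
  -- The relation `α P_k = P_(k+1) + [k] P_k` passes from the `P k` to powers of `α`.
  have hαN : ∀ j k, k + j ≤ p - 1 → α ^ j * P k ∈ LinearMap.range Ψ := by
    intro j
    induction j with
    | zero =>
      intro k hk
      rw [pow_zero, one_mul]
      exact hPN (p - 1 - k) k (by omega)
    | succ j ih =>
      intro k hk
      have h1 : α ^ (j + 1) * P k =
          α ^ j * P (k + 1) + (∑ i ∈ Finset.range k, ρ ^ i) • (α ^ j * P k) := by
        simp only [hP]
        rw [Finset.prod_range_succ, Algebra.smul_def, map_sum]
        simp only [map_pow]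
        ring
      rw [h1]
      exact Submodule.add_mem _ (ih _ (by omega)) (Submodule.smul_mem _ _ (ih _ (by omega)))
  have hsurj : Function.Surjective Ψ := by
    intro s
    obtain ⟨c, rfl⟩ := hbij.2 s
    rw [Fintype.linearCombination_apply]
    refine Submodule.sum_mem (LinearMap.range Ψ) fun j _ => Submodule.smul_mem _ _ ?_
    simpa [hP] using hαN j 0 (by omega)
  have := hGal.finite
  let e : R[G] ≃ₗ[R] S := (MonoidAlgebra.coeffLinearEquiv R).trans <|
    (Finsupp.linearEquivFunOnFinite R R G).trans <|
    (LinearEquiv.funCongrLeft R R (Fintype.equivFinOfCardEq hcard).symm).trans <|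
    LinearEquiv.ofBijective _ hbij
  exact nonempty_linearEquiv_groupRing_of_bijective (P (p - 1))
    ⟨OrzechProperty.injective_of_surjective_of_injective e.toLinearMap Ψ e.injective hsurj, hsurj⟩

end NormalBasis

/-! ### Lagrange resolvents and invertibility of `1 + ηα` -/

section Unit

variable {R S G : Type*} [CommRing R] [CommRing S] [Algebra R S]
  [Group G] [MulSemiringAction G S] [SMulCommClass G R S]

theorem pow_mul_smul_sum_pow_mul_pow_smul {p : ℕ} {σ : G} (hσp : σ ^ p = 1) {q : S}
    (hq : q ^ p = 1) (hσq : σ • q = q) (i : ℕ) (s : S) :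
    q ^ i * σ • ∑ j ∈ Finset.range p, q ^ (i * j) * σ ^ j • s =
      ∑ j ∈ Finset.range p, q ^ (i * j) * σ ^ j • s := by
  have h1 := (Finset.sum_range_succ' (fun j => q ^ (i * j) * σ ^ j • s) p).symm.trans
    (Finset.sum_range_succ (fun j => q ^ (i * j) * σ ^ j • s) p)
  have h2 : q ^ (i * p) * σ ^ p • s = q ^ (i * 0) * σ ^ 0 • s := by
    rw [mul_comm i p, pow_mul, hq, hσp]
    simp
  rw [h2, add_left_inj] at h1
  conv_rhs => rw [← h1]
  rw [Finset.smul_sum, Finset.mul_sum]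
  refine Finset.sum_congr rfl fun j _ => ?_
  rw [smul_mul', smul_pow', hσq, smul_smul, ← pow_succ', mul_add, mul_one, pow_add]
  ring

/-- If the eigenspace of `σ` for `ρ` is contained in a prime ideal `M` with `p ∉ M`, then `σ`
acts trivially modulo `M`. -/
theorem smul_sub_mem_of_eigenspace_le {p : ℕ} (hp : p.Prime) {σ : G} (hσp : σ ^ p = 1) {q : S}
    (hq : ∑ i ∈ Finset.range p, q ^ i = 0) (hσq : σ • q = q) (M : Ideal S) [M.IsPrime]
    (hpM : (p : S) ∉ M) (hM : ∀ x : S, σ • x = q * x → x ∈ M) (s : S) : σ • s - s ∈ M := by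
  have hqp : q ^ p = 1 := by
    have := geom_sum_mul q p
    rw [hq, zero_mul] at this
    exact sub_eq_zero.1 this.symm
  have hcop : ∀ i, 0 < i → i < p → i.Coprime p := fun i h0 hi =>
    Nat.Coprime.symm ((Nat.Prime.coprime_iff_not_dvd hp).2 (Nat.not_dvd_of_pos_of_lt h0 hi))
  -- With `i * l ≡ 1` mod `p`, the power `x ^ (l * (p - 1))` is a `q`-eigenvector, and `M` is prime.
  have heig : ∀ i, 0 < i → i < p → ∀ x : S, q ^ i * σ • x = x → x ∈ M := by
    intro i h0 hi x hx
    obtain ⟨l, hl⟩ := Nat.exists_mul_mod_eq_one_of_coprime (hcop i h0 hi) hp.one_lt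
    have hx' : x ^ (l * (p - 1)) ∈ M := by
      apply hM
      have hqi : q ^ (i * l) = q := by
        rw [← Nat.div_add_mod (i * l) p, hl.2, pow_add, pow_mul, hqp, one_pow, one_mul, pow_one]
      have h1 := congrArg (· ^ (l * (p - 1))) hx
      simp only [mul_pow] at h1
      rw [← pow_mul, ← mul_assoc, pow_mul, hqi, ← smul_pow'] at h1
      conv_rhs => rw [← h1, ← mul_assoc, ← pow_succ', Nat.sub_add_cancel hp.one_le, hqp, one_mul]
    exact Ideal.IsPrime.mem_of_pow_mem ‹_› _ hx'
  have hgeom : ∀ j, 0 < j → j < p → ∑ i ∈ Finset.range p, (q ^ j) ^ i = 0 := by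
    intro j h0 hj
    have h1 := geom_sum_range_mul q j p
    rw [mul_comm j p, geom_sum_range_mul, hq, zero_mul] at h1
    exact ((isUnit_geom_sum_of_coprime hp.one_lt hq (hcop j h0 hj)).mul_right_eq_zero).1 h1.symm
  -- The resolvents of `s` add up to `p * s`; modulo `M` only the trace, `i = 0`, survives.
  have htr : ∀ s : S, (p : S) * s - ∑ j ∈ Finset.range p, σ ^ j • s ∈ M := by
    intro s
    have h1 : ∑ i ∈ Finset.range p, ∑ j ∈ Finset.range p, q ^ (i * j) * σ ^ j • s = p * s := by
      rw [Finset.sum_comm, Finset.sum_eq_single_of_mem 0 (Finset.mem_range.2 hp.pos)]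
      · simp
      · intro j hj h0
        rw [← Finset.sum_mul]
        simp_rw [mul_comm _ j, pow_mul]
        rw [hgeom j (Nat.pos_of_ne_zero h0) (Finset.mem_range.1 hj), zero_mul]
    rw [← h1, ← Nat.sub_add_cancel hp.one_le, Finset.sum_range_succ', Nat.sub_add_cancel hp.one_le]
    simp only [zero_mul, pow_zero, one_mul, add_sub_cancel_right]
    refine M.sum_mem fun i hi => heig (i + 1) (Nat.succ_pos i) ?_ _
      (pow_mul_smul_sum_pow_mul_pow_smul hσp hqp hσq (i + 1) s)
    have := Finset.mem_range.1 hi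
    omega
  have hinv : ∑ j ∈ Finset.range p, σ ^ j • σ • s = ∑ j ∈ Finset.range p, σ ^ j • s := by
    have := pow_mul_smul_sum_pow_mul_pow_smul hσp hqp hσq 0 s
    simpa [Finset.smul_sum, smul_smul, ← pow_succ, ← pow_succ'] using this
  have h2 := M.sub_mem (htr (σ • s)) (htr s)
  rw [hinv, sub_sub_sub_cancel_right, ← mul_sub] at h2
  exact (Ideal.IsPrime.mem_or_mem ‹_› h2).resolve_left hpM

theorem IsGaloisRingExtension.isUnit_of_eigenspace_le [Fintype G] {p : ℕ} (hp : p.Prime) {σ : G}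
    (hσ1 : σ ≠ 1) (hσp : σ ^ p = 1) {ρ : R} (hρ : ∑ i ∈ Finset.range p, ρ ^ i = 0)
    (hGal : IsGaloisRingExtension R S G) {α : S}
    (hα : ∀ x : S, σ • x = algebraMap R S ρ * x → 1 + α * algebraMap R S (ρ - 1) ∣ x) :
    IsUnit (1 + α * algebraMap R S (ρ - 1)) := by
  by_contra hu
  obtain ⟨M, hM, hvM⟩ := exists_max_ideal_of_mem_nonunits hu
  have := hM.isPrime
  set q := algebraMap R S ρ with hq
  have hq0 : ∑ i ∈ Finset.range p, q ^ i = 0 := by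
    simpa using congrArg (algebraMap R S) hρ
  have hqM : q - 1 ∉ M := fun h => hM.ne_top <| (Ideal.eq_top_iff_one M).2 <| by
    rw [map_sub, map_one, ← hq] at hvM
    simpa using M.sub_mem hvM (M.mul_mem_left α h)
  -- Expanding `q ^ p = 1` around `1` shows that `p` divides `(q - 1) ^ p`.
  have hpM : (p : S) ∉ M := by
    intro h
    obtain ⟨r, hr⟩ := exists_add_pow_prime_eq hp (q - 1) 1
    have h1 := geom_sum_mul q p
    rw [sub_add_cancel, one_pow] at hr
    rw [hq0, zero_mul, hr] at h1
    refine hqM (Ideal.IsPrime.mem_of_pow_mem this p ?_)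
    have h2 : (q - 1) ^ p = -(p * ((q - 1) * r)) := by linear_combination -h1
    rw [h2]
    exact M.neg_mem (M.mul_mem_right _ h)
  obtain ⟨s, hs⟩ := hGal.exists_smul_sub_notMem hσ1 M hM.ne_top
  exact hs (smul_sub_mem_of_eigenspace_le hp hσp hq0 (smul_algebraMap σ ρ) M hpM
    (fun x hx => M.mem_of_dvd (hα x hx) hvM) s)

end Unit

/-! ### Annihilators in the group ring -/

section GroupRing

variable {R G : Type*} [CommRing R] [CommGroup G]

/-- The annihilator of `σ - c` in `R[G]` is generated over `R` by `Q(σ)`, where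
`X ^ p - 1 = (X - c) Q`. -/
theorem MonoidAlgebra.exists_eq_smul_aeval_of_sub_mul_eq_zero {p : ℕ} {σ : G}
    (hσ : Subgroup.zpowers σ = ⊤) (hord : orderOf σ = p) (hp : 0 < p) {c : R}
    {Q : Polynomial R} (hQ : Polynomial.X ^ p - 1 = (Polynomial.X - Polynomial.C c) * Q)
    {x : R[G]} (hx : (of R G σ - algebraMap R R[G] c) * x = 0) :
    ∃ r : R, x = r • Polynomial.aeval (of R G σ) Q := by
  classical
  have hc : c ^ p = 1 := by
    have := congrArg (Polynomial.eval c) hQ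
    simpa [sub_eq_zero] using this
  have hQ' : Q = ∑ i ∈ Finset.range p, Polynomial.X ^ i * Polynomial.C c ^ (p - 1 - i) := by
    refine (Polynomial.monic_X_sub_C c).isRegular.left ?_
    change (Polynomial.X - Polynomial.C c) * Q = (Polynomial.X - Polynomial.C c) * _
    rw [← hQ, mul_comm, Commute.geom_sum₂_mul (Commute.all _ _), ← map_pow, hc, map_one]
  have hstep : ∀ g : G, x.coeff g = c * x.coeff (σ * g) := by
    intro g
    rw [sub_mul, sub_eq_zero, ← Algebra.smul_def] at hx
    have := congrArg (fun y : R[G] => y.coeff (σ * g)) hx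
    simpa [of_apply] using this
  have hcoeff : ∀ i < p, x.coeff (σ ^ i) = c ^ (p - 1 - i) * x.coeff (σ ^ (p - 1)) := by
    have : ∀ d i, i + d = p - 1 → x.coeff (σ ^ i) = c ^ d * x.coeff (σ ^ (p - 1)) := by
      intro d
      induction d with
      | zero => rintro i h; simp [← h]
      | succ d ih =>
        intro i h
        rw [hstep, ← pow_succ', ih (i + 1) (by omega), pow_succ']
        ring
    exact fun i hi => this _ i (by omega)
  -- `Q` is monic of degree `p - 1`, so the top coefficient of `x` is the scalar.
  refine ⟨x.coeff (σ ^ (p - 1)), ?_⟩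
  have hsum : Polynomial.aeval (of R G σ) Q =
      ∑ i ∈ Finset.range p, single (σ ^ i) (c ^ (p - 1 - i)) := by
    rw [hQ', map_sum]
    refine Finset.sum_congr rfl fun i _ => ?_
    rw [← map_pow, map_mul, map_pow, Polynomial.aeval_X, Polynomial.aeval_C, mul_comm,
      ← Algebra.smul_def, ← map_pow, of_apply]
    simp
  rw [hsum]
  ext g
  obtain ⟨n, rfl⟩ : ∃ n : ℕ, σ ^ n = g :=
    (Submonoid.mem_powers_iff _ _).1 ((isOfFinOrder_iff_pow_eq_one.2
      ⟨p, hp, hord ▸ pow_orderOf_eq_one σ⟩).mem_powers_iff_mem_zpowers.2 (hσ ▸ Subgroup.mem_top g))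
  obtain ⟨j, hj, hjn⟩ : ∃ j < p, σ ^ n = σ ^ j :=
    ⟨n % p, Nat.mod_lt n hp, by rw [← hord, pow_mod_orderOf]⟩
  rw [hjn, hcoeff j hj, coeff_smul, Finsupp.smul_apply, coeff_sum, Finsupp.finsetSum_apply,
    Finset.sum_eq_single_of_mem j (Finset.mem_range.2 hj)]
  · simp [mul_comm]
  · intro i hi hij
    rw [coeff_single, Finsupp.single_apply, if_neg]
    intro h2
    exact hij (pow_injOn_Iio_orderOf (by simpa [hord] using hi) (by simpa [hord] using hj) h2)

end GroupRing

/-! ### From `S(1)` back to `α` -/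

section FirstLayer

variable {R S G : Type*} [CommRing R] [CommRing S] [Algebra R S]
  [CommGroup G] [MulSemiringAction G S] [SMulCommClass G R S]

/-- An isomorphism `M(1) ≅ R[G](1)` provides a generator `a` of `M(1)` such that `(σ - ρ) a` and
`(σ - 1) a` span the eigenspaces of `σ` for `1` and `ρ`. -/
theorem exists_generator_of_firstLayer_equiv [Fintype G] {p : ℕ} (hp : p.Prime)
    (hcard : Fintype.card G = p) {σ : G} (hσ : Subgroup.zpowers σ = ⊤) {ρ : R}
    (hρ : (Polynomial.cyclotomic p R).IsRoot ρ) {M : Type*} [AddCommGroup M] [Module R[G] M]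
    (e : firstLayer σ ρ M ≃ₗ[R[G]] firstLayer σ ρ R[G]) :
    ∃ a ∈ firstLayer σ ρ M,
      (∀ x : M, (MonoidAlgebra.of R G σ - 1) • x = 0 →
        ∃ r : R, x = algebraMap R R[G] r •
          (MonoidAlgebra.of R G σ - algebraMap R R[G] ρ) • a) ∧
      ∀ x : M, (MonoidAlgebra.of R G σ - algebraMap R R[G] ρ) • x = 0 →
        ∃ r : R, x = algebraMap R R[G] r • (MonoidAlgebra.of R G σ - 1) • a := by
  have hord : orderOf σ = p := by
    rw [← hcard, ← Nat.card_eq_fintype_card]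
    exact orderOf_eq_card_of_forall_mem_zpowers (fun x => hσ ▸ Subgroup.mem_top x)
  have hfac := X_pow_sub_one_eq_prod_of_isRoot_cyclotomic hp hρ
  rw [← Finset.prod_range_mul_prod_Ico _ hp.two_le, Finset.prod_range_succ,
    Finset.prod_range_one, pow_zero, pow_one] at hfac
  set f : Polynomial R := ∏ i ∈ Finset.Ico 2 p, (Polynomial.X - Polynomial.C (ρ ^ i)) with hf
  have hφf : Polynomial.aeval (MonoidAlgebra.of R G σ) f =
      ∏ i ∈ Finset.Ico 2 p, (MonoidAlgebra.of R G σ - algebraMap R R[G] (ρ ^ i)) := by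
    simp [hf]
  have hfmem : Polynomial.aeval (MonoidAlgebra.of R G σ) f ∈ firstLayer σ ρ R[G] := by
    rw [firstLayer_groupRing hp hcard σ hσ ρ hρ, hφf]
    exact Ideal.mem_span_singleton_self _
  have key : ∀ c d : R, Polynomial.X ^ p - 1 =
      (Polynomial.X - Polynomial.C c) * ((Polynomial.X - Polynomial.C d) * f) →
      ∀ x : firstLayer σ ρ M, (MonoidAlgebra.of R G σ - algebraMap R R[G] c) • x = 0 →
      ∃ r : R, x = algebraMap R R[G] r • (MonoidAlgebra.of R G σ - algebraMap R R[G] d) •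
        e.symm ⟨_, hfmem⟩ := by
    intro c d hcd x hx
    have h1 : (MonoidAlgebra.of R G σ - algebraMap R R[G] c) * (e x : R[G]) = 0 := by
      have := congrArg (fun y => ((e y : firstLayer σ ρ R[G]) : R[G])) hx
      rwa [map_smul, map_zero] at this
    obtain ⟨r, hr⟩ :=
      MonoidAlgebra.exists_eq_smul_aeval_of_sub_mul_eq_zero hσ hord hp.pos hcd h1
    refine ⟨r, e.injective (Subtype.ext ?_)⟩
    rw [hr, map_smul, map_smul, LinearEquiv.apply_symm_apply, Algebra.smul_def]
    simp
  refine ⟨_, (e.symm ⟨_, hfmem⟩).2, fun x hx => ?_, fun x hx => ?_⟩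
  · have hmem : x ∈ firstLayer σ ρ M := by
      rw [firstLayer, Submodule.mem_torsionBy_iff, mul_smul, hx, smul_zero]
    obtain ⟨r, hr⟩ := key 1 ρ (by rw [hfac, mul_assoc]) ⟨x, hmem⟩
      (Subtype.ext (by rwa [map_one]))
    exact ⟨r, congrArg Subtype.val hr⟩
  · have hmem : x ∈ firstLayer σ ρ M := by
      rw [firstLayer, Submodule.mem_torsionBy_iff, mul_comm, mul_smul, hx, smul_zero]
    obtain ⟨r, hr⟩ := key ρ 1 (by rw [hfac]; ring) ⟨x, hmem⟩ (Subtype.ext hx)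
    rw [map_one] at hr
    exact ⟨r, congrArg Subtype.val hr⟩

theorem IsGaloisRingExtension.exists_of_firstLayer_equiv [Fintype G] {p : ℕ} (hp : p.Prime)
    (hcard : Fintype.card G = p) {σ : G} (hσ : Subgroup.zpowers σ = ⊤) {ρ : R}
    (hρ : (Polynomial.cyclotomic p R).IsRoot ρ) (hGal : IsGaloisRingExtension R S G)
    (e : firstLayer σ ρ (GaloisModule R S G) ≃ₗ[R[G]] firstLayer σ ρ R[G]) :
    ∃ α : S, σ • α = algebraMap R S ρ * α + 1 ∧ IsUnit (1 + α * algebraMap R S (ρ - 1)) := by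
  have hσp : σ ^ p = 1 := hcard ▸ pow_card_eq_one
  have hσ1 : σ ≠ 1 := by
    rintro rfl
    have h1 := orderOf_eq_card_of_forall_mem_zpowers
      (fun x : G => hσ ▸ Subgroup.mem_top x)
    rw [orderOf_one, Nat.card_eq_fintype_card, hcard] at h1
    exact hp.one_lt.ne h1
  have hρ' : ∑ i ∈ Finset.range p, ρ ^ i = 0 := by
    have := Fact.mk hp
    simpa [Polynomial.cyclotomic_prime, Polynomial.IsRoot, Polynomial.eval_finsetSum] using hρ
  obtain ⟨a, ha, ha1, haρ⟩ := exists_generator_of_firstLayer_equiv hp hcard hσ hρ e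
  set E := (Representation.ofDistribMulAction R G S).asModuleEquiv with hE
  obtain ⟨b, rfl⟩ := E.symm.surjective a
  have hsub : ∀ (c : R) (s : S), (MonoidAlgebra.of R G σ - algebraMap R R[G] c) • E.symm s =
      E.symm (σ • s - c • s) := fun c s => by
    apply E.injective
    simp [hE, Algebra.algebraMap_eq_smul_one]
  have hsub1 : ∀ s : S, (MonoidAlgebra.of R G σ - 1) • E.symm s = E.symm (σ • s - s) := fun s => by
    simpa only [map_one, one_smul] using hsub 1 s
  have hr : ∀ (c : R) (s : S), algebraMap R R[G] c • E.symm s = E.symm (c • s) := fun c s =>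
    (Representation.asModuleEquiv_symm_map_smul _ c s).symm
  rw [firstLayer, Submodule.mem_torsionBy_iff, mul_comm, mul_smul, hsub, hsub1,
    LinearEquiv.map_eq_zero_iff, sub_eq_zero] at ha
  simp only [hsub, hsub1, hr] at ha1 haρ
  obtain ⟨u, hu⟩ := hGal.exists_algebraMap_eq_of_smul_eq (smul_eq_of_zpowers_eq_top hσ ha)
  obtain ⟨r, hr1⟩ := ha1 (E.symm 1) (by rw [hsub1, smul_one, sub_self, map_zero])
  have hr1 : (1 : S) = r • (σ • b - ρ • b) := E.symm.injective hr1
  -- Here `u = (σ - ρ)b` lies in `R` and `1 = r u`, so `α = r b` works.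
  have hru : r * u = 1 := hGal.injective (by
    rw [map_mul, hu, map_one, ← Algebra.smul_def, ← hr1])
  have hα : σ • (r • b) = algebraMap R S ρ * (r • b) + 1 := by
    rw [hr1, smul_comm σ r b, smul_sub, smul_comm r ρ b, ← Algebra.smul_def]
    abel
  refine ⟨r • b, hα, hGal.isUnit_of_eigenspace_le hp hσ1 hσp hρ' fun x hx => ?_⟩
  obtain ⟨t, ht⟩ := haρ (E.symm x) (by
    rw [hsub, hx, ← Algebra.smul_def, sub_self, map_zero])
  have ht : x = t • (σ • b - b) := E.symm.injective ht
  have hv : 1 + (r • b) * algebraMap R S (ρ - 1) = r • (σ • b - b) := by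
    rw [smul_sub, ← smul_comm σ r b, hα, map_sub, map_one]
    ring
  refine ⟨algebraMap R S (t * u), ?_⟩
  rw [hv, mul_comm, ← Algebra.smul_def, smul_smul, mul_assoc, mul_comm u, hru, mul_one, ht]

theorem nonempty_firstLayer_equiv {M N : Type*} [AddCommGroup M] [Module R[G] M]
    [AddCommGroup N] [Module R[G] N] (σ : G) (ρ : R) (e : M ≃ₗ[R[G]] N) :
    Nonempty (firstLayer σ ρ M ≃ₗ[R[G]] firstLayer σ ρ N) := by
  refine ⟨e.ofSubmodules _ _ ?_⟩
  ext y
  rw [Submodule.mem_map_equiv, firstLayer, firstLayer, Submodule.mem_torsionBy_iff,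
    Submodule.mem_torsionBy_iff, ← map_smul, LinearEquiv.map_eq_zero_iff]

end FirstLayer

theorem mainTheorem8 {R S G : Type*} [CommRing R] [CommRing S] [Algebra R S]
    [CommGroup G] [Fintype G] [MulSemiringAction G S] [SMulCommClass G R S]
    (p : ℕ) (hp : p.Prime) (hcard : Fintype.card G = p)
    (σ : G) (hσ : Subgroup.zpowers σ = ⊤)
    (ρ : R) (hρ : (Polynomial.cyclotomic p R).IsRoot ρ)
    (hGal : IsGaloisRingExtension R S G) :
    List.TFAE [
      ∃ α : S, σ • α = algebraMap R S ρ * α + 1 ∧ IsUnit (1 + α * algebraMap R S (ρ - 1)),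
      Nonempty (firstLayer σ ρ (GaloisModule R S G) ≃ₗ[R[G]] firstLayer σ ρ R[G]),
      Nonempty (GaloisModule R S G ≃ₗ[R[G]] R[G])] := by
  have hρ' : ∑ i ∈ Finset.range p, ρ ^ i = 0 := by
    have := Fact.mk hp
    simpa [Polynomial.cyclotomic_prime, Polynomial.IsRoot, Polynomial.eval_finsetSum] using hρ
  tfae_have 1 → 3 := fun ⟨_, hα, hu⟩ =>
    hGal.nonempty_linearEquiv_groupRing hp hcard hσ hρ' hα hu
  tfae_have 3 → 2 := fun ⟨e⟩ => nonempty_firstLayer_equiv σ ρ e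
  tfae_have 2 → 1 := fun ⟨e⟩ => hGal.exists_of_firstLayer_equiv hp hcard hσ hρ e
  tfae_finish
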